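/- **Theorem (Bayes' theorem for upper probabilities).** *Conventions.* For a set $\mathcal P$ of (countably additive) probability measures on a measurable space $(\Omega,\mathcal F)$, its upper probability is $\overline P(A)=\sup_{P\in\mathcal P}P(A)$, $A\in\mathcal F$, with conjugate lower probability $\underline P(A)=1-\overline P(A^c)$, and $\mathrm{core}(\overline P)$ is the set of all (countably additive) probability measures $P$ on $(\Omega,\mathcal F)$ with $P(A)\le\overline P(A)$ for all $A\in\mathcal F$. $\overline P$ is concave (2-alternating) if $\overline P(A\cup B)\le\overline P(A)+\overline P(B)-\overline P(A\cap B)$ for all $A,B\in\mathcal F$. A set of probability measures is weak$^\star$-closed if it is closed, under setwise convergence of nets, in the space of all finitely additive probabilities on $\mathcal F$. *Setting.* Let $(\Theta,\mathcal F)$ and $(\mathscr D,\mathcal A)$ be measurable spaces (parameters and data), with $\sigma$-finite measures $\mu$ and $\nu$ respectively. Let $\mathcal P$ be a set of probability measures on $\Theta$ with upper probability $\overline P$, and let $\mathcal P^{co}=\mathrm{core}(\overline P)$; every $P\in\mathcal P^{co}$ has a density $dP/d\mu$. For each $\theta\in\Theta$ let $\mathcal L_\theta$ be a set of probability measures on $\mathscr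 D$ with upper probability $\overline P_\theta$, and let $\mathcal L^{co}_\theta=\mathrm{core}(\overline P_\theta)$. Suppose that every $Q\in\mathcal L^{co}_\theta$ has a density with respect to $\nu$, and fix non-negative measurable versions $dQ/d\nu$ of these densities (the version may depend on $\theta$), chosen such that for each $\theta$ the density of a mixture is the corresponding mixture of the densities, at every point of $\mathscr D$. Fix $y\in\mathscr D$ and suppose that the numbers $\frac{dQ}{d\nu}(y)$, $\theta\in\Theta$, $Q\in\mathcal L^{co}_\theta$, are bounded. Let $\mathscr L$ be the set of all bounded, non-negative, $\mathcal F$-measurable functions $L:\Theta\to\mathbb R$ of the form $L(\theta)=\frac{dP_\theta}{d\nu}(y)$ with $P_\theta\in\mathcal L^{co}_\theta$ for every $\theta\in\Theta$. Put $\overline L(\theta)=\sup_{L\in\mathscr L}L(\theta)$ and $\underline L(\theta)=\inf_{L\in\mathscr L}L(\theta)$, and suppose that these two functions are $\mathcal F$-measurable. Let $\mathcal P^{co}_y$ be the set of the probability measures $P_y$ on $\Theta$ with $$\frac{dP_y}{d\mu}=\frac{L\,p}{\int_\Theta L\,p\,d\mu},\qquad p=\frac{dP}{d\mu},\ P\in\mathcal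 P^{co},\ L\in\mathscr L,\ \int_\Theta L\,p\,d\mu>0,$$ and let $\overline P_y(A)=\sup_{P_y\in\mathcal P^{co}_y}P_y(A)$. *Claim.* Suppose that $\mathcal P^{co}$ and all $\mathcal L^{co}_\theta$, $\theta\in\Theta$, are nonempty and weak$^\star$-closed. Then for all $A\in\mathcal F$, $$\overline P_y(A)\ \le\ \frac{\sup_{P\in\mathcal P^{co}}\int_\Theta\overline L\,\mathbb 1_A\,dP}{\mathbf c}\ \le\ \frac{\int_0^\infty\overline P(\{\overline L\,\mathbb 1_A>t\})\,dt}{\mathbf c'},$$ where $$\mathbf c=\sup_{P\in\mathcal P^{co}}\int_\Theta\overline L\,\mathbb 1_A\,dP+\inf_{P\in\mathcal P^{co}}\int_\Theta\underline L\,\mathbb 1_{A^c}\,dP,\qquad \mathbf c'=\int_0^\infty\overline P(\{\overline L\,\mathbb 1_A>t\})\,dt+\int_0^\infty\underline P(\{\underline L\,\mathbb 1_{A^c}>t\})\,dt,$$ whenever the ratios are well defined, that is, the first inequality holds if $\mathbf c\ne0$ (in which case $\mathcal P^{co}_y\neq\emptyset$), and the second if $\mathbf c\neq 0$ and $\mathbf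 c'\ne0$. If, in addition, $\overline P$ is concave, then both inequalities are equalities (under the same provisos). -/

import Mathlib

open MeasureTheory Set
open scoped ENNReal

noncomputable section

namespace UpperBayes

variable {Ω Θ D : Type*} [MeasurableSpace Ω] [MeasurableSpace Θ] [MeasurableSpace D]

/-- The upper probability `A ↦ sup_{P ∈ 𝓟} P(A)` of a set `𝓟` of probability measures. -/
def upperProb (𝓟 : Set (ProbabilityMeasure Ω)) (A : Set Ω) : ℝ :=
  sSup ((fun P : ProbabilityMeasure Ω => (P : Measure Ω).real A) '' 𝓟)

/-- The conjugate set function `A ↦ 1 - v(Aᶜ)`; the lower probability if `v` is an upper one. -/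
def conj (v : Set Ω → ℝ) (A : Set Ω) : ℝ := 1 - v Aᶜ

/-- The (countably additive) core: the probability measures dominated setwise by `v`. -/
def core (v : Set Ω → ℝ) : Set (ProbabilityMeasure Ω) :=
  {P | ∀ A, MeasurableSet A → (P : Measure Ω).real A ≤ v A}

/-- Concave (2-alternating) set functions. -/
def Concave (v : Set Ω → ℝ) : Prop :=
  ∀ A B, MeasurableSet A → MeasurableSet B → v (A ∪ B) ≤ v A + v B - v (A ∩ B)

/-- Weak-star closedness, that is, closedness under setwise convergence of nets. The ambient space
is that of all *finitely additive* probabilities on the measurable sets. As that space is itself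
closed in the product space of all real functions on the measurable sets, it is the same to ask
for closedness in the product space. -/
def IsWeakStarClosed (𝓟 : Set (ProbabilityMeasure Ω)) : Prop :=
  IsClosed ((fun (P : ProbabilityMeasure Ω) (A : {A : Set Ω // MeasurableSet A}) =>
    (P : Measure Ω).real A.1) '' 𝓟)

/-- The bounded, non-negative, measurable functionals on `Θ`. -/
def bddNonneg (Θ : Type*) [MeasurableSpace Θ] : Set (Θ → ℝ) :=
  {f | Measurable f ∧ (∀ θ, 0 ≤ f θ) ∧ ∃ C, ∀ θ, f θ ≤ C}

/-- `p θ P` is, for every parameter `θ` and every `P ∈ K θ`, a version of the density `dP/dν`.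
The value of a density at the observed point depends on the version, so versions are fixed; they
are chosen such that the density of a mixture is the mixture of the densities. -/
structure IsDensityVersion (ν : Measure D) (K : Θ → Set (ProbabilityMeasure D))
    (p : Θ → ProbabilityMeasure D → D → ℝ) : Prop where
  measurable : ∀ θ, ∀ P ∈ K θ, Measurable (p θ P)
  nonneg : ∀ θ, ∀ P ∈ K θ, ∀ z, 0 ≤ p θ P z
  withDensity : ∀ θ, ∀ P ∈ K θ,
    (P : Measure D) = ν.withDensity (fun z => ENNReal.ofReal (p θ P z))
  mixture : ∀ θ, ∀ P ∈ K θ, ∀ Q ∈ K θ, ∀ R ∈ K θ, ∀ a b : ℝ, 0 ≤ a → 0 ≤ b → a + b = 1 →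
    (R : Measure D) = ENNReal.ofReal a • (P : Measure D) + ENNReal.ofReal b • (Q : Measure D) →
    ∀ z, p θ R z = a * p θ P z + b * p θ Q z

/-- The set of likelihood functions at the datum `y`: the bounded non-negative measurable functions
`L(θ) = (dP_θ/dν)(y)` where `P_θ ∈ K θ` for every `θ`. -/
def likelihoods (K : Θ → Set (ProbabilityMeasure D)) (p : Θ → ProbabilityMeasure D → D → ℝ)
    (y : D) : Set (Θ → ℝ) :=
  {L | L ∈ bddNonneg Θ ∧ ∃ P : Θ → ProbabilityMeasure D,
    (∀ θ, P θ ∈ K θ) ∧ ∀ θ, L θ = p θ (P θ) y}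

/-- The upper likelihood `θ ↦ sup_{L ∈ 𝓛} L(θ)`. -/
def upperLik (𝓛 : Set (Θ → ℝ)) (θ : Θ) : ℝ := sSup ((fun L => L θ) '' 𝓛)

/-- The lower likelihood `θ ↦ inf_{L ∈ 𝓛} L(θ)`. -/
def lowerLik (𝓛 : Set (Θ → ℝ)) (θ : Θ) : ℝ := sInf ((fun L => L θ) '' 𝓛)

/-- The set of posteriors: the probability measures with density `L p / ∫ L p dμ` with respect to
`μ`, for a prior `P ∈ 𝓟` with density `p = dP/dμ` and a likelihood `L ∈ 𝓛` for which the
normalizing constant is positive. -/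
def posteriors (μ : Measure Θ) (𝓟 : Set (ProbabilityMeasure Θ)) (𝓛 : Set (Θ → ℝ)) :
    Set (ProbabilityMeasure Θ) :=
  {Q | ∃ P ∈ 𝓟, ∃ L ∈ 𝓛,
    0 < ∫ τ, L τ * ((P : Measure Θ).rnDeriv μ τ).toReal ∂μ ∧
    (Q : Measure Θ) = μ.withDensity (fun θ => ENNReal.ofReal
      (L θ * ((P : Measure Θ).rnDeriv μ θ).toReal /
        ∫ τ, L τ * ((P : Measure Θ).rnDeriv μ τ).toReal ∂μ))}

/-- `sup_{P ∈ 𝓟} ∫ f dP`. -/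
def supExp (𝓟 : Set (ProbabilityMeasure Ω)) (f : Ω → ℝ) : ℝ :=
  sSup ((fun P : ProbabilityMeasure Ω => ∫ ω, f ω ∂(P : Measure Ω)) '' 𝓟)

/-- `inf_{P ∈ 𝓟} ∫ f dP`. -/
def infExp (𝓟 : Set (ProbabilityMeasure Ω)) (f : Ω → ℝ) : ℝ :=
  sInf ((fun P : ProbabilityMeasure Ω => ∫ ω, f ω ∂(P : Measure Ω)) '' 𝓟)

/-- The Choquet integral `∫₀^∞ v({f > t}) dt` of a non-negative function. -/
def choquet (v : Set Ω → ℝ) (f : Ω → ℝ) : ℝ := ∫ t in Ioi (0 : ℝ), v {ω | t < f ω}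

end UpperBayes

end

/-! A posterior from a prior `P` and a likelihood `L` gives `A` the mass `x / (x + z)`, where `x`
and `z` are the `P`-integrals of `L` over `A` and over its complement. This ratio increases in `x`
and decreases in `z` (`div_add_le_div_add`). The first bound follows by putting the envelopes in
place of `L` and optimizing over `P` separately in `x` and `z`. The second follows from the
layer-cake formula, since every core member lies between the lower and the upper probability on each
level set.

Equality requires one prior that optimizes both terms at once. The level sets of the upper
likelihood on `A`, together with the complements of the level sets of the lower likelihood off `A`,
form a chain (`isChain_levels`). A submodular capacity agrees along any chain with some modular
capacity below it (`IsSubmodularCapacity.exists_modular_le`, by Zorn's lemma). Weak-star compactness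
of the core makes the upper probability continuous at the empty set, so the modular capacity is a
measure in the core (`exists_mem_core_eq_on_chain`).

One likelihood must also approach both envelopes. Cores are convex and densities respect mixtures,
so measurable functions squeezed pointwise between likelihoods are likelihoods. Truncating a given
likelihood against the envelopes therefore works (`exists_likelihood_near_envelopes`), and the error
tends to zero. -/

namespace UpperBayes

/-! ### Submodular capacities and modular minorants -/

section Modular

variable {α : Type*} [BooleanAlgebra α]

/-- A normalized, monotone and submodular real function on a Boolean algebra. -/
structure IsSubmodularCapacity (v : α → ℝ) : Prop where
  bot : v ⊥ = 0
  top : v ⊤ = 1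
  mono : Monotone v
  submod : ∀ a b, v (a ⊔ b) + v (a ⊓ b) ≤ v a + v b

/-- The modification of `v` that is additive with respect to splitting along `b`. -/
def splitAlong (v : α → ℝ) (b a : α) : ℝ := v (a ⊓ b) + v (a ⊔ b) - v b

lemma IsSubmodularCapacity.nonneg {v : α → ℝ} (hv : IsSubmodularCapacity v) (a : α) : 0 ≤ v a :=
  hv.bot ▸ hv.mono bot_le

/-- By distributivity, meeting and joining with `b` are lattice homomorphisms, so both summands
inherit submodularity. -/
lemma isSubmodularCapacity_splitAlong {v : α → ℝ} (hv : IsSubmodularCapacity v) (b : α) :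
    IsSubmodularCapacity (splitAlong v b) where
  bot := by simp [splitAlong, hv.bot]
  top := by simp [splitAlong, hv.top]
  mono := fun x y hxy => by
    have h₁ := hv.mono (inf_le_inf_right b hxy)
    have h₂ := hv.mono (sup_le_sup_right hxy b)
    simp only [splitAlong]
    linarith
  submod := fun x y => by
    have h₁ := hv.submod (x ⊓ b) (y ⊓ b)
    have h₂ := hv.submod (x ⊔ b) (y ⊔ b)
    rw [← inf_sup_right, ← inf_inf_distrib_right] at h₁
    rw [← sup_inf_right, ← sup_sup_distrib_right] at h₂
    simp only [splitAlong]
    linarith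

lemma IsSubmodularCapacity.splitAlong_le {v : α → ℝ} (hv : IsSubmodularCapacity v) (b : α) :
    splitAlong v b ≤ v := fun a => by
  have := hv.submod a b
  simp only [splitAlong]
  linarith

lemma splitAlong_eq_of_le (v : α → ℝ) {a b : α} (h : a ≤ b ∨ b ≤ a) : splitAlong v b a = v a := by
  rcases h with h | h
  · simp [splitAlong, inf_eq_left.2 h, sup_eq_right.2 h]
  · simp [splitAlong, inf_eq_right.2 h, sup_eq_left.2 h]

lemma IsSubmodularCapacity.one_le_add_compl {v : α → ℝ} (hv : IsSubmodularCapacity v) (b : α) :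
    1 ≤ v b + v bᶜ := by
  simpa [hv.top, hv.bot] using hv.submod b bᶜ

/-- Near-minimizers at `a` and at `b` are comparable in the chain, so the smaller one serves both,
and its submodularity passes to the infimum. -/
lemma isSubmodularCapacity_iInf {c : Set (α → ℝ)} (hc : IsChain (· ≤ ·) c) (hne : c.Nonempty)
    (h : ∀ w ∈ c, IsSubmodularCapacity w) :
    IsSubmodularCapacity (fun a => ⨅ w : c, w.1 a) := by
  have : Nonempty c := hne.to_subtype
  have hbdd : ∀ a, BddBelow (range fun w : c => w.1 a) := fun a =>
    ⟨0, by rintro _ ⟨w, rfl⟩; exact (h _ w.2).nonneg a⟩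
  refine ⟨?_, ?_, fun x y hxy => ?_, fun a b => ?_⟩
  · simp [fun w : c => (h _ w.2).bot]
  · simp [fun w : c => (h _ w.2).top]
  · exact ciInf_mono (hbdd x) fun w => (h _ w.2).mono hxy
  · refine le_of_forall_pos_le_add fun ε hε => ?_
    obtain ⟨w₁, h₁⟩ := exists_lt_of_ciInf_lt (lt_add_of_pos_right (⨅ w : c, w.1 a) (half_pos hε))
    obtain ⟨w₂, h₂⟩ := exists_lt_of_ciInf_lt (lt_add_of_pos_right (⨅ w : c, w.1 b) (half_pos hε))
    obtain ⟨w, hw₁, hw₂⟩ : ∃ w : c, w.1 ≤ w₁.1 ∧ w.1 ≤ w₂.1 := by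
      rcases hc.total w₁.2 w₂.2 with h' | h'
      exacts [⟨w₁, le_rfl, h'⟩, ⟨w₂, h', le_rfl⟩]
    have := (h _ w.2).submod a b
    have h₃ := ciInf_le (hbdd (a ⊔ b)) w
    have h₄ := ciInf_le (hbdd (a ⊓ b)) w
    have h₅ := hw₁ a
    have h₆ := hw₂ b
    linarith

/-- A submodular capacity dominates a modular one that agrees with it along a given chain. -/
theorem IsSubmodularCapacity.exists_modular_le {v : α → ℝ} (hv : IsSubmodularCapacity v)
    {C : Set α} (hC : IsChain (· ≤ ·) C) :
    ∃ m : α → ℝ, IsSubmodularCapacity m ∧ (∀ a b, m (a ⊔ b) + m (a ⊓ b) = m a + m b) ∧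
      m ≤ v ∧ ∀ b ∈ C, m b = v b := by
  let S : Set (α → ℝ) := {w | IsSubmodularCapacity w ∧ w ≤ v ∧ ∀ b ∈ C, w b = v b}
  obtain ⟨m, ⟨hm, hmv, hmC⟩, hmin⟩ : ∃ m : α → ℝ, m ∈ S ∧ ∀ w ∈ S, w ≤ m → m ≤ w := by
    -- Zorn in the order dual gives a minimal element, with pointwise infima as lower bounds of
    -- chains.
    obtain ⟨m, -, hm, hmin⟩ := @zorn_le_nonempty₀ (α → ℝ)ᵒᵈ _ S
      (fun c hcS hc y hy => by
        have hne : Set.Nonempty c := ⟨y, hy⟩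
        have hbdd : ∀ a, BddBelow (range fun w : c => (w.1 : α → ℝ) a) := fun a =>
          ⟨0, by rintro _ ⟨w, rfl⟩; exact (hcS w.2).1.nonneg a⟩
        have : Nonempty c := hne.to_subtype
        refine ⟨fun a => ⨅ w : c, (w.1 : α → ℝ) a,
          ⟨isSubmodularCapacity_iInf hc.symm hne fun w hw => (hcS hw).1, fun a => ?_, fun b hb => ?_⟩,
          fun w hw a => ciInf_le (hbdd a) ⟨w, hw⟩⟩
        · exact (ciInf_le (hbdd a) ⟨y, hy⟩).trans ((hcS hy).2.1 a)
        · simp [fun w : c => (hcS w.2).2.2 b hb]) v ⟨hv, le_rfl, fun _ _ => rfl⟩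
    exact ⟨m, hm, fun w hw h => hmin hw h⟩
  -- Splitting along `b` lowers `m`, so by minimality it changes nothing as soon as it preserves the
  -- values on `C`.
  have key : ∀ b, (∀ x ∈ C, splitAlong m b x = m x) → splitAlong m b = m := fun b hb =>
    le_antisymm (hm.splitAlong_le b) <| hmin _
      ⟨isSubmodularCapacity_splitAlong hm b, (hm.splitAlong_le b).trans hmv,
        fun x hx => (hb x hx).trans (hmC x hx)⟩
      (hm.splitAlong_le b)
  -- Members of `C` are comparable with `b`, so splitting along `b` preserves their values; evaluate
  -- at the complement of `b`.
  have hcompl : ∀ b ∈ C, m b + m bᶜ = 1 := fun b hb => by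
    have h := congrFun (key b fun x hx => splitAlong_eq_of_le m (hC.total hx hb)) bᶜ
    simp only [splitAlong, compl_inf_eq_bot, compl_sup_eq_top, hm.bot, hm.top] at h
    linarith
  -- For arbitrary `b`, the split values at `x` and its complement sum to at least 1, while the
  -- larger `m`-values sum to exactly 1; hence they agree at `x`.
  have hall : ∀ b, splitAlong m b = m := fun b => key b fun x hx => by
    have h₁ := hcompl x hx
    have h₂ := (isSubmodularCapacity_splitAlong hm b).one_le_add_compl x
    have h₃ := hm.splitAlong_le b x
    have h₄ := hm.splitAlong_le b xᶜ
    linarith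
  refine ⟨m, hm, fun a b => ?_, hmv, hmC⟩
  have h := congrFun (hall b) a
  simp only [splitAlong] at h
  linarith

end Modular

/-! ### Upper probabilities, their cores, and attainment on chains -/

section Core

variable {Ω : Type*} [MeasurableSpace Ω]

lemma bddAbove_real_image (𝓟 : Set (ProbabilityMeasure Ω)) (A : Set Ω) :
    BddAbove ((fun P : ProbabilityMeasure Ω => (P : Measure Ω).real A) '' 𝓟) :=
  ⟨1, by rintro _ ⟨P, -, rfl⟩; exact measureReal_le_one⟩

lemma real_le_upperProb {𝓟 : Set (ProbabilityMeasure Ω)} {P : ProbabilityMeasure Ω} (hP : P ∈ 𝓟)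
    (A : Set Ω) : (P : Measure Ω).real A ≤ upperProb 𝓟 A :=
  le_csSup (bddAbove_real_image 𝓟 A) ⟨P, hP, rfl⟩

lemma upperProb_nonneg (𝓟 : Set (ProbabilityMeasure Ω)) (A : Set Ω) : 0 ≤ upperProb 𝓟 A :=
  Real.sSup_nonneg (by rintro _ ⟨P, -, rfl⟩; exact measureReal_nonneg)

lemma upperProb_le_one (𝓟 : Set (ProbabilityMeasure Ω)) (A : Set Ω) : upperProb 𝓟 A ≤ 1 :=
  Real.sSup_le (by rintro _ ⟨P, -, rfl⟩; exact measureReal_le_one) zero_le_one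

lemma subset_core_upperProb (𝓟 : Set (ProbabilityMeasure Ω)) : 𝓟 ⊆ core (upperProb 𝓟) :=
  fun _ hP A _ => real_le_upperProb hP A

lemma nonempty_of_core_upperProb {𝓟 : Set (ProbabilityMeasure Ω)}
    (h : (core (upperProb 𝓟)).Nonempty) : 𝓟.Nonempty := by
  by_contra! h𝓟
  obtain ⟨P, hP⟩ := h
  have := hP univ MeasurableSet.univ
  simp only [upperProb, h𝓟, image_empty, Real.sSup_empty, probReal_univ] at this
  linarith

lemma upperProb_empty (𝓟 : Set (ProbabilityMeasure Ω)) : upperProb 𝓟 ∅ = 0 :=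
  le_antisymm (Real.sSup_le (by rintro _ ⟨P, -, rfl⟩; simp) le_rfl) (upperProb_nonneg _ _)

lemma upperProb_univ {𝓟 : Set (ProbabilityMeasure Ω)} (h𝓟 : 𝓟.Nonempty) :
    upperProb 𝓟 univ = 1 := by
  obtain ⟨P, hP⟩ := h𝓟
  refine le_antisymm (upperProb_le_one _ _) ?_
  simpa using real_le_upperProb hP univ

lemma upperProb_mono (𝓟 : Set (ProbabilityMeasure Ω)) : Monotone (upperProb 𝓟) := fun _ B hAB =>
  Real.sSup_le (by
    rintro _ ⟨P, hP, rfl⟩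
    exact (measureReal_mono hAB).trans (real_le_upperProb hP B)) (upperProb_nonneg _ _)

lemma Concave.isSubmodularCapacity {𝓟 : Set (ProbabilityMeasure Ω)} (h𝓟 : 𝓟.Nonempty)
    (hv : Concave (upperProb 𝓟)) :
    IsSubmodularCapacity fun A : {A : Set Ω // MeasurableSet A} => upperProb 𝓟 A.1 where
  bot := upperProb_empty 𝓟
  top := upperProb_univ h𝓟
  mono := fun _ _ h => upperProb_mono 𝓟 h
  submod := fun A B => by
    have := hv A.1 B.1 A.2 B.2
    change upperProb 𝓟 (A.1 ∪ B.1) + upperProb 𝓟 (A.1 ∩ B.1) ≤ _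
    linarith

/-- The upper probability of a set with a weak-star closed core is continuous from above at `∅`. -/
lemma exists_upperProb_le_of_antitone {𝓟 : Set (ProbabilityMeasure Ω)}
    (hcl : IsWeakStarClosed (core (upperProb 𝓟))) {s : ℕ → Set Ω} (hs : ∀ n, MeasurableSet (s n))
    (hanti : Antitone s) (hempty : ⋂ n, s n = ∅) {ε : ℝ} (hε : 0 < ε) :
    ∃ n, upperProb 𝓟 (s n) ≤ ε := by
  by_contra! hlt
  let e : ProbabilityMeasure Ω → {A : Set Ω // MeasurableSet A} → ℝ := fun P A =>
    (P : Measure Ω).real A.1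
  -- The core is a closed subset of the cube of all functions into `[0, 1]`, which is compact by
  -- Tychonoff.
  have hcomp : IsCompact (e '' core (upperProb 𝓟)) :=
    (isCompact_univ_pi fun _ => isCompact_Icc (a := (0 : ℝ)) (b := 1)).of_isClosed_subset hcl (by
      rintro _ ⟨P, -, rfl⟩ A -
      exact ⟨measureReal_nonneg, measureReal_le_one⟩)
  let t : ℕ → Set ({A : Set Ω // MeasurableSet A} → ℝ) := fun n =>
    e '' core (upperProb 𝓟) ∩ {x | ε ≤ x ⟨s n, hs n⟩}
  have htcl : ∀ n, IsClosed (t n) := fun n =>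
    hcl.inter (isClosed_le continuous_const (continuous_apply _))
  obtain ⟨x, hx⟩ := IsCompact.nonempty_iInter_of_sequence_nonempty_isCompact_isClosed t
    (fun n => by
      rintro _ ⟨⟨P, hP, rfl⟩, h⟩
      exact ⟨⟨P, hP, rfl⟩, le_trans h (measureReal_mono (hanti n.le_succ))⟩)
    (fun n => by
      have : ∃ P ∈ 𝓟, ε < (P : Measure Ω).real (s n) := by
        by_contra! h
        exact (hlt n).not_ge (Real.sSup_le (by rintro _ ⟨P, hP, rfl⟩; exact h P hP) hε.le)
      obtain ⟨P, hP, h⟩ := this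
      exact ⟨e P, ⟨P, subset_core_upperProb 𝓟 hP, rfl⟩, h.le⟩)
    (hcomp.of_isClosed_subset (htcl 0) inter_subset_left) htcl
  rw [mem_iInter] at hx
  -- The common point lies in the core itself, hence is countably additive, yet keeps mass at least
  -- `ε` on every `s n`.
  obtain ⟨⟨P, -, rfl⟩, -⟩ := hx 0
  have hlim := tendsto_measure_iInter_atTop (μ := (P : Measure Ω))
    (fun n => (hs n).nullMeasurableSet) hanti ⟨0, measure_ne_top _ _⟩
  rw [hempty, measure_empty] at hlim
  have hlim' := (ENNReal.tendsto_toReal ENNReal.zero_ne_top).comp hlim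
  exact hε.not_ge (ge_of_tendsto' hlim' fun n => (hx n).2)

/-- A finitely additive probability that vanishes along sequences decreasing to `∅` is a probability
measure. -/
lemma exists_probabilityMeasure_of_modular {m : {A : Set Ω // MeasurableSet A} → ℝ}
    (hm : IsSubmodularCapacity m) (hadd : ∀ a b, m (a ⊔ b) + m (a ⊓ b) = m a + m b)
    (hcont : ∀ s : ℕ → {A : Set Ω // MeasurableSet A}, Antitone s → ⋂ n, (s n).1 = ∅ →
      ∀ ε > 0, ∃ n, m (s n) ≤ ε) :
    ∃ P : ProbabilityMeasure Ω, ∀ A, (P : Measure Ω).real A.1 = m A := by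
  have hhasSum : ∀ f : ℕ → Set Ω, Pairwise (Function.onFun Disjoint f) →
      ∀ (hf : ∀ i, MeasurableSet (f i)) (hU : MeasurableSet (⋃ i, f i)),
      HasSum (fun i => m ⟨f i, hf i⟩) (m ⟨⋃ i, f i, hU⟩) := by
    intro f hd hf hU
    have hT : ∀ n, MeasurableSet (⋃ i, ⋃ (_ : n ≤ i), f i) := fun n =>
      MeasurableSet.iUnion fun i => MeasurableSet.iUnion fun _ => hf i
    -- The tails decrease to the empty set and make the partial sums telescope.
    let s : ℕ → {A : Set Ω // MeasurableSet A} := fun n => ⟨⋃ i, ⋃ (_ : n ≤ i), f i, hT n⟩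
    have hs : Antitone s := fun n k hnk => by
      change (⋃ i, ⋃ (_ : k ≤ i), f i) ⊆ ⋃ i, ⋃ (_ : n ≤ i), f i
      exact iUnion_mono fun i => iUnion_mono' fun h => ⟨hnk.trans h, subset_rfl⟩
    have hse : ⋂ n, (s n).1 = ∅ := by
      refine eq_empty_iff_forall_notMem.2 fun x hx => ?_
      simp only [s, mem_iInter, mem_iUnion] at hx
      obtain ⟨i, -, hi⟩ := hx 0
      obtain ⟨j, hj, hj'⟩ := hx (i + 1)
      exact Set.disjoint_left.1 (hd (show i ≠ j by omega)) hi hj'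
    have hstep : ∀ n, m (s n) = m ⟨f n, hf n⟩ + m (s (n + 1)) := fun n => by
      rw [← hadd]
      have h₁ : (⟨f n, hf n⟩ : {A : Set Ω // MeasurableSet A}) ⊔ s (n + 1) = s n := by
        apply Subtype.ext
        change f n ∪ (⋃ i, ⋃ (_ : n + 1 ≤ i), f i) = ⋃ i, ⋃ (_ : n ≤ i), f i
        ext x
        simp only [mem_union, mem_iUnion, exists_prop]
        constructor
        · rintro (h | ⟨i, hi, h⟩)
          exacts [⟨n, le_rfl, h⟩, ⟨i, by omega, h⟩]
        · rintro ⟨i, hi, h⟩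
          rcases hi.eq_or_lt with rfl | hlt
          exacts [Or.inl h, Or.inr ⟨i, hlt, h⟩]
      have h₂ : (⟨f n, hf n⟩ : {A : Set Ω // MeasurableSet A}) ⊓ s (n + 1) = ⊥ := by
        apply Subtype.ext
        change f n ∩ (⋃ i, ⋃ (_ : n + 1 ≤ i), f i) = ∅
        refine eq_empty_iff_forall_notMem.2 fun x hx => ?_
        simp only [mem_inter_iff, mem_iUnion] at hx
        obtain ⟨h, j, hj, hj'⟩ := hx
        exact Set.disjoint_left.1 (hd (show n ≠ j by omega)) h hj'
      rw [h₁, h₂, hm.bot, add_zero]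
    have hsum : ∀ n, ∑ i ∈ Finset.range n, m ⟨f i, hf i⟩ = m (s 0) - m (s n) := fun n => by
      induction n with
      | zero => simp
      | succ k ih => rw [Finset.sum_range_succ, ih, hstep k]; ring
    have hs0 : s 0 = ⟨⋃ i, f i, hU⟩ := by
      apply Subtype.ext
      simp [s]
    rw [hasSum_iff_tendsto_nat_of_nonneg fun i => hm.nonneg _]
    simp only [hsum, hs0]
    have hlim : Filter.Tendsto (fun n => m (s n)) Filter.atTop (nhds 0) := by
      refine Metric.tendsto_atTop.2 fun ε hε => ?_
      obtain ⟨n, hn⟩ := hcont s hs hse (ε / 2) (half_pos hε)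
      refine ⟨n, fun k hk => ?_⟩
      have := hm.mono (hs hk)
      rw [Real.dist_eq, sub_zero, abs_of_nonneg (hm.nonneg _)]
      linarith
    simpa using hlim.const_sub (m ⟨⋃ i, f i, hU⟩)
  let μ : Measure Ω := Measure.ofMeasurable (fun A hA => ENNReal.ofReal (m ⟨A, hA⟩))
    (by
      have : m ⟨∅, MeasurableSet.empty⟩ = 0 := hm.bot
      exact ENNReal.ofReal_eq_zero.2 this.le)
    (fun f hf hd => by
      have h := hhasSum f hd hf (MeasurableSet.iUnion hf)
      rw [← h.tsum_eq, ENNReal.ofReal_tsum_of_nonneg (fun i => hm.nonneg _) h.summable])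
  have hμ : ∀ A hA, μ A = ENNReal.ofReal (m ⟨A, hA⟩) := fun A hA =>
    Measure.ofMeasurable_apply A hA
  have htop : m ⟨univ, MeasurableSet.univ⟩ = 1 := hm.top
  refine ⟨⟨μ, ⟨by rw [hμ _ .univ, htop, ENNReal.ofReal_one]⟩⟩, fun A => ?_⟩
  change μ.real A.1 = m A
  rw [Measure.real, hμ _ A.2, ENNReal.toReal_ofReal (hm.nonneg _)]

/-- A concave upper probability with a weak-star closed core is attained, simultaneously on all the
sets of a given chain, by a member of the core. -/
theorem exists_mem_core_eq_on_chain {𝓟 : Set (ProbabilityMeasure Ω)} (h𝓟 : 𝓟.Nonempty)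
    (hcl : IsWeakStarClosed (core (upperProb 𝓟))) (hv : Concave (upperProb 𝓟))
    {C : Set (Set Ω)} (hC : IsChain (· ⊆ ·) C) :
    ∃ P ∈ core (upperProb 𝓟), ∀ A ∈ C, MeasurableSet A →
      (P : Measure Ω).real A = upperProb 𝓟 A := by
  obtain ⟨m, hm, hadd, hmv, hmC⟩ := (hv.isSubmodularCapacity h𝓟).exists_modular_le
    (C := {A | A.1 ∈ C}) (fun A hA B hB hAB => hC hA hB fun h => hAB (Subtype.ext h))
  obtain ⟨P, hP⟩ := exists_probabilityMeasure_of_modular hm hadd fun s hs hse ε hε => by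
    obtain ⟨n, hn⟩ := exists_upperProb_le_of_antitone hcl (fun n => (s n).2)
      (fun i j hij => hs hij) hse hε
    exact ⟨n, (hmv (s n)).trans hn⟩
  exact ⟨P, fun A hA => (hP ⟨A, hA⟩).trans_le (hmv ⟨A, hA⟩),
    fun A hAC hA => (hP ⟨A, hA⟩).trans (hmC ⟨A, hA⟩ hAC)⟩

end Core

/-! ### Level sets -/

section LevelSets

variable {Ω : Type*}

lemma choquet_congr {v w : Set Ω → ℝ} {f : Ω → ℝ}
    (h : ∀ t : ℝ, 0 < t → v {ω | t < f ω} = w {ω | t < f ω}) : choquet v f = choquet w f :=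
  setIntegral_congr_fun measurableSet_Ioi fun t ht => h t ht

lemma choquet_nonneg {v : Set Ω → ℝ} (hv : ∀ A, 0 ≤ v A) (f : Ω → ℝ) : 0 ≤ choquet v f :=
  integral_nonneg fun _ => hv _

lemma conj_monotone {v : Set Ω → ℝ} (hv : Monotone v) : Monotone (conj v) := fun A B hAB => by
  have := hv (compl_subset_compl.2 hAB)
  simp only [conj]
  linarith

/-- Positive levels of `f` lie inside `A`, and complements of positive levels of `g` contain `A`.
Complements appear because the conjugate of a set is read off from its complement. -/
lemma isChain_levels {f g : Ω → ℝ} {A : Set Ω} (hf : ∀ ω ∉ A, f ω ≤ 0) (hg : ∀ ω ∈ A, g ω ≤ 0) :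
    IsChain (· ⊆ ·)
      ({s | ∃ t : ℝ, 0 < t ∧ s = {ω | t < f ω}} ∪ {s | ∃ t : ℝ, 0 < t ∧ s = {ω | t < g ω}ᶜ}) := by
  have hfg : ∀ s t : ℝ, 0 < s → 0 < t → {ω | s < f ω} ⊆ {ω | t < g ω}ᶜ := by
    intro s t hs ht ω (h₁ : s < f ω) (h₂ : t < g ω)
    by_cases hω : ω ∈ A
    · exact (ht.trans h₂).not_ge (hg ω hω)
    · exact (hs.trans h₁).not_ge (hf ω hω)
  rintro _ (⟨s, hs, rfl⟩ | ⟨s, hs, rfl⟩) _ (⟨t, ht, rfl⟩ | ⟨t, ht, rfl⟩) -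
  · rcases le_total s t with h | h
    · exact Or.inr fun ω (hω : t < f ω) => h.trans_lt hω
    · exact Or.inl fun ω (hω : s < f ω) => h.trans_lt hω
  · exact Or.inl (hfg s t hs ht)
  · exact Or.inr (hfg t s ht hs)
  · rcases le_total s t with h | h
    · exact Or.inl (compl_subset_compl.2 fun ω (hω : t < g ω) => h.trans_lt hω)
    · exact Or.inr (compl_subset_compl.2 fun ω (hω : s < g ω) => h.trans_lt hω)

end LevelSets

/-! ### Choquet integrals as bounds for integrals over the core -/

section Choquet

variable {Ω : Type*} [MeasurableSpace Ω]

lemma integrable_of_mem_bddNonneg {f : Ω → ℝ} (hf : f ∈ bddNonneg Ω) (P : Measure Ω)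
    [IsFiniteMeasure P] : Integrable f P := by
  obtain ⟨hm, h0, C, hC⟩ := hf
  refine Integrable.of_bound hm.aestronglyMeasurable C (ae_of_all _ fun ω => ?_)
  rw [Real.norm_eq_abs, abs_of_nonneg (h0 ω)]
  exact hC ω

lemma indicator_mem_bddNonneg {f : Ω → ℝ} (hf : f ∈ bddNonneg Ω) {A : Set Ω}
    (hA : MeasurableSet A) : A.indicator f ∈ bddNonneg Ω := by
  obtain ⟨hm, h0, C, hC⟩ := hf
  exact ⟨hm.indicator hA, fun ω => indicator_nonneg (fun ω _ => h0 ω) ω, C, fun ω =>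
    (indicator_le_self' (fun ω _ => h0 ω) ω).trans (hC ω)⟩

/-- The integrand is antitone in `t` and vanishes beyond a bound of `f`. -/
lemma integrableOn_level {v : Set Ω → ℝ} (hv : Monotone v) (hv0 : v ∅ = 0) {f : Ω → ℝ}
    (hf : f ∈ bddNonneg Ω) : IntegrableOn (fun t : ℝ => v {ω | t < f ω}) (Ioi 0) := by
  obtain ⟨C, hC⟩ := hf.2.2
  have hanti : Antitone fun t : ℝ => v {ω | t < f ω} := fun s t hst =>
    hv fun ω (hω : t < f ω) => hst.trans_lt hω
  refine ((hanti.locallyIntegrable (μ := volume)).integrableOn_isCompact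
    (isCompact_Icc (a := 0) (b := C))).of_forall_sdiff_eq_zero measurableSet_Ioi fun t ht => ?_
  have hCt : C < t := by
    by_contra! h
    exact ht.2 ⟨le_of_lt ht.1, h⟩
  have : {ω | t < f ω} = ∅ := eq_empty_iff_forall_notMem.2 fun ω (hω : t < f ω) =>
    (hCt.trans hω).not_ge (hC ω)
  rw [this, hv0]

lemma choquet_mono {v w : Set Ω → ℝ} (hv : Monotone v) (hv0 : v ∅ = 0) (hw : Monotone w)
    (hw0 : w ∅ = 0) (hvw : ∀ A, MeasurableSet A → v A ≤ w A) {f : Ω → ℝ} (hf : f ∈ bddNonneg Ω) :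
    choquet v f ≤ choquet w f :=
  setIntegral_mono (integrableOn_level hv hv0 hf) (integrableOn_level hw hw0 hf) fun _ =>
    hvw _ (measurableSet_lt measurable_const hf.1)

lemma integral_eq_choquet {f : Ω → ℝ} (hf : f ∈ bddNonneg Ω) (P : ProbabilityMeasure Ω) :
    ∫ ω, f ω ∂(P : Measure Ω) = choquet (P : Measure Ω).real f :=
  (integrable_of_mem_bddNonneg hf _).integral_eq_integral_meas_lt (ae_of_all _ hf.2.1)

lemma measureReal_monotone (P : ProbabilityMeasure Ω) : Monotone (P : Measure Ω).real :=
  fun _ _ h => measureReal_mono h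

lemma conj_le_of_mem_core {v : Set Ω → ℝ} {P : ProbabilityMeasure Ω} (hP : P ∈ core v) {A : Set Ω}
    (hA : MeasurableSet A) : conj v A ≤ (P : Measure Ω).real A := by
  have h := hP Aᶜ hA.compl
  rw [probReal_compl_eq_one_sub hA] at h
  simp only [conj]
  linarith

variable {𝓟 : Set (ProbabilityMeasure Ω)} {f : Ω → ℝ}

lemma conj_upperProb_empty (h𝓟 : 𝓟.Nonempty) : conj (upperProb 𝓟) ∅ = 0 := by
  simp [conj, upperProb_univ h𝓟]

lemma conj_upperProb_nonneg (𝓟 : Set (ProbabilityMeasure Ω)) (A : Set Ω) :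
    0 ≤ conj (upperProb 𝓟) A :=
  sub_nonneg.2 (upperProb_le_one _ _)

lemma integral_le_choquet (hf : f ∈ bddNonneg Ω) {P : ProbabilityMeasure Ω}
    (hP : P ∈ core (upperProb 𝓟)) : ∫ ω, f ω ∂(P : Measure Ω) ≤ choquet (upperProb 𝓟) f := by
  rw [integral_eq_choquet hf]
  exact choquet_mono (measureReal_monotone P) measureReal_empty (upperProb_mono 𝓟)
    (upperProb_empty 𝓟) hP hf

lemma choquet_conj_le_integral (h𝓟 : 𝓟.Nonempty) (hf : f ∈ bddNonneg Ω)
    {P : ProbabilityMeasure Ω} (hP : P ∈ core (upperProb 𝓟)) :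
    choquet (conj (upperProb 𝓟)) f ≤ ∫ ω, f ω ∂(P : Measure Ω) := by
  rw [integral_eq_choquet hf]
  exact choquet_mono (conj_monotone (upperProb_mono 𝓟)) (conj_upperProb_empty h𝓟)
    (measureReal_monotone P) measureReal_empty (fun _ hA => conj_le_of_mem_core hP hA) hf

lemma supExp_le_choquet (hf : f ∈ bddNonneg Ω) :
    supExp (core (upperProb 𝓟)) f ≤ choquet (upperProb 𝓟) f :=
  Real.sSup_le (by rintro _ ⟨P, hP, rfl⟩; exact integral_le_choquet hf hP)
    (choquet_nonneg (upperProb_nonneg 𝓟) f)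

lemma choquet_conj_le_infExp (hne : (core (upperProb 𝓟)).Nonempty) (hf : f ∈ bddNonneg Ω) :
    choquet (conj (upperProb 𝓟)) f ≤ infExp (core (upperProb 𝓟)) f :=
  le_csInf (hne.image _) (by
    rintro _ ⟨P, hP, rfl⟩
    exact choquet_conj_le_integral (nonempty_of_core_upperProb hne) hf hP)

lemma integral_le_supExp (hf : f ∈ bddNonneg Ω) {P : ProbabilityMeasure Ω} (hP : P ∈ 𝓟) :
    ∫ ω, f ω ∂(P : Measure Ω) ≤ supExp 𝓟 f := by
  obtain ⟨C, hC⟩ := hf.2.2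
  refine le_csSup ⟨C, ?_⟩ ⟨P, hP, rfl⟩
  rintro _ ⟨Q, -, rfl⟩
  simpa using integral_mono (integrable_of_mem_bddNonneg hf (Q : Measure Ω))
    (integrable_const C) hC

lemma infExp_le_integral (hf : f ∈ bddNonneg Ω) {P : ProbabilityMeasure Ω} (hP : P ∈ 𝓟) :
    infExp 𝓟 f ≤ ∫ ω, f ω ∂(P : Measure Ω) := by
  refine csInf_le ⟨0, ?_⟩ ⟨P, hP, rfl⟩
  rintro _ ⟨Q, -, rfl⟩
  exact integral_nonneg hf.2.1

lemma supExp_nonneg (hf : f ∈ bddNonneg Ω) : 0 ≤ supExp 𝓟 f :=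
  Real.sSup_nonneg (by rintro _ ⟨Q, -, rfl⟩; exact integral_nonneg hf.2.1)

lemma infExp_nonneg (hf : f ∈ bddNonneg Ω) : 0 ≤ infExp 𝓟 f :=
  Real.sInf_nonneg (by rintro _ ⟨Q, -, rfl⟩; exact integral_nonneg hf.2.1)

/-- For a concave upper probability with a weak-star closed core, a single member of the core attains
the upper Choquet integral of a function supported in `A` and the lower one of a function supported
in the complement of `A`. -/
theorem exists_mem_core_integral_eq_choquet (h𝓟 : 𝓟.Nonempty)
    (hcl : IsWeakStarClosed (core (upperProb 𝓟))) (hv : Concave (upperProb 𝓟))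
    {f g : Ω → ℝ} (hf : f ∈ bddNonneg Ω) (hg : g ∈ bddNonneg Ω) {A : Set Ω}
    (hfA : ∀ ω ∉ A, f ω ≤ 0) (hgA : ∀ ω ∈ A, g ω ≤ 0) :
    ∃ P ∈ core (upperProb 𝓟), ∫ ω, f ω ∂(P : Measure Ω) = choquet (upperProb 𝓟) f ∧
      ∫ ω, g ω ∂(P : Measure Ω) = choquet (conj (upperProb 𝓟)) g := by
  obtain ⟨P, hP, h⟩ := exists_mem_core_eq_on_chain h𝓟 hcl hv (isChain_levels hfA hgA)
  refine ⟨P, hP, ?_, ?_⟩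
  · rw [integral_eq_choquet hf]
    exact choquet_congr fun t ht =>
      h _ (Or.inl ⟨t, ht, rfl⟩) (measurableSet_lt measurable_const hf.1)
  · rw [integral_eq_choquet hg]
    refine choquet_congr fun t ht => ?_
    have hmeas : MeasurableSet {ω | t < g ω} := measurableSet_lt measurable_const hg.1
    rw [conj, ← h _ (Or.inr ⟨t, ht, rfl⟩) hmeas.compl, probReal_compl_eq_one_sub hmeas,
      sub_sub_cancel]

end Choquet

/-! ### Likelihood functions and their envelopes -/

section Likelihood

variable {Θ D : Type*} [MeasurableSpace Θ] [MeasurableSpace D]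

lemma exists_mixture_mem_core {v : Set D → ℝ} {P Q : ProbabilityMeasure D} (hP : P ∈ core v)
    (hQ : Q ∈ core v) {a b : ℝ} (ha : 0 ≤ a) (hb : 0 ≤ b) (hab : a + b = 1) :
    ∃ R ∈ core v, (R : Measure D) =
      ENNReal.ofReal a • (P : Measure D) + ENNReal.ofReal b • (Q : Measure D) := by
  refine ⟨⟨ENNReal.ofReal a • (P : Measure D) + ENNReal.ofReal b • (Q : Measure D), ⟨?_⟩⟩,
    fun A hA => ?_, rfl⟩
  · simp [← ENNReal.ofReal_add ha hb, hab]
  · change (ENNReal.ofReal a • (P : Measure D) + ENNReal.ofReal b • (Q : Measure D)).real A ≤ v A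
    rw [measureReal_add_apply (ENNReal.mul_ne_top ENNReal.ofReal_ne_top (measure_ne_top _ _))
        (ENNReal.mul_ne_top ENNReal.ofReal_ne_top (measure_ne_top _ _)),
      measureReal_ennreal_smul_apply, measureReal_ennreal_smul_apply,
      ENNReal.toReal_ofReal ha, ENNReal.toReal_ofReal hb]
    calc _ ≤ a * v A + b * v A := add_le_add (mul_le_mul_of_nonneg_left (hP A hA) ha)
          (mul_le_mul_of_nonneg_left (hQ A hA) hb)
      _ = v A := by rw [← add_mul, hab, one_mul]

variable {ν : Measure D} {v : Θ → Set D → ℝ} {p : Θ → ProbabilityMeasure D → D → ℝ} {y : D}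

/-- A measurable function that lies pointwise between likelihood functions is one itself. -/
lemma mem_likelihoods_of_between (hp : IsDensityVersion ν (fun θ => core (v θ)) p) {C : ℝ}
    (hC : ∀ θ, ∀ P ∈ core (v θ), p θ P y ≤ C) {f : Θ → ℝ} (hf : Measurable f)
    (h : ∀ θ, ∃ L₁ ∈ likelihoods (fun θ => core (v θ)) p y,
      ∃ L₂ ∈ likelihoods (fun θ => core (v θ)) p y, L₁ θ ≤ f θ ∧ f θ ≤ L₂ θ) :
    f ∈ likelihoods (fun θ => core (v θ)) p y := by
  have hmem : ∀ θ, ∃ R ∈ core (v θ), f θ = p θ R y := by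
    intro θ
    obtain ⟨L₁, ⟨-, P, hP, hPL⟩, L₂, ⟨-, Q, hQ, hQL⟩, h₁, h₂⟩ := h θ
    rw [hPL] at h₁
    rw [hQL] at h₂
    -- Convex weights producing the value `f θ` also mix the two measures, and the mixture's density
    -- at `y` is then `f θ`.
    obtain ⟨a, b, ha, hb, hab, hfab⟩ : f θ ∈ segment ℝ (p θ (P θ) y) (p θ (Q θ) y) := by
      rw [segment_eq_Icc (h₁.trans h₂)]
      exact ⟨h₁, h₂⟩
    obtain ⟨R, hR, hRab⟩ := exists_mixture_mem_core (hP θ) (hQ θ) ha hb hab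
    refine ⟨R, hR, ?_⟩
    rw [hp.mixture θ _ (hP θ) _ (hQ θ) R hR a b ha hb hab hRab y, ← hfab, smul_eq_mul, smul_eq_mul]
  choose R hR hfR using hmem
  refine ⟨⟨hf, fun θ => ?_, C, fun θ => ?_⟩, R, hR, hfR⟩
  · rw [hfR]
    exact hp.nonneg θ _ (hR θ) y
  · rw [hfR]
    exact hC θ _ (hR θ)

variable {K : Θ → Set (ProbabilityMeasure D)} {C : ℝ}

lemma le_upperLik (hC : ∀ θ, ∀ P ∈ K θ, p θ P y ≤ C) {L : Θ → ℝ} (hL : L ∈ likelihoods K p y)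
    (θ : Θ) : L θ ≤ upperLik (likelihoods K p y) θ := by
  refine le_csSup ⟨C, ?_⟩ ⟨L, hL, rfl⟩
  rintro _ ⟨L, ⟨-, P, hP, h⟩, rfl⟩
  exact (h θ).trans_le (hC θ _ (hP θ))

lemma lowerLik_le {L : Θ → ℝ} (hL : L ∈ likelihoods K p y) (θ : Θ) :
    lowerLik (likelihoods K p y) θ ≤ L θ := by
  refine csInf_le ⟨0, ?_⟩ ⟨L, hL, rfl⟩
  rintro _ ⟨L, hL, rfl⟩
  exact hL.1.2.1 θ

lemma upperLik_mem_bddNonneg (hC : ∀ θ, ∀ P ∈ K θ, p θ P y ≤ C)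
    (hmeas : Measurable (upperLik (likelihoods K p y))) :
    upperLik (likelihoods K p y) ∈ bddNonneg Θ := by
  refine ⟨hmeas, fun θ => Real.sSup_nonneg ?_, max C 0, fun θ => Real.sSup_le ?_ (le_max_right _ _)⟩
  · rintro _ ⟨L, hL, rfl⟩
    exact hL.1.2.1 θ
  · rintro _ ⟨L, ⟨-, P, hP, h⟩, rfl⟩
    exact ((h θ).trans_le (hC θ _ (hP θ))).trans (le_max_left _ _)

lemma lowerLik_mem_bddNonneg (hC : ∀ θ, ∀ P ∈ K θ, p θ P y ≤ C)
    (hmeas : Measurable (lowerLik (likelihoods K p y))) :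
    lowerLik (likelihoods K p y) ∈ bddNonneg Θ := by
  refine ⟨hmeas, fun θ => Real.sInf_nonneg ?_, max C 0, fun θ => ?_⟩
  · rintro _ ⟨L, hL, rfl⟩
    exact hL.1.2.1 θ
  · rcases (likelihoods K p y).eq_empty_or_nonempty with h | ⟨L, hL⟩
    · simp [lowerLik, h]
    · obtain ⟨-, P, hP, hPL⟩ := id hL
      exact (lowerLik_le hL θ).trans (((hPL θ).trans_le (hC θ _ (hP θ))).trans (le_max_left _ _))

/-- A likelihood function that is almost maximal on `A` and almost minimal off `A`. -/
lemma exists_likelihood_near_envelopes (hp : IsDensityVersion ν (fun θ => core (v θ)) p)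
    (hC : ∀ θ, ∀ P ∈ core (v θ), p θ P y ≤ C)
    (hne : (likelihoods (fun θ => core (v θ)) p y).Nonempty)
    (hup : Measurable (upperLik (likelihoods (fun θ => core (v θ)) p y)))
    (hlow : Measurable (lowerLik (likelihoods (fun θ => core (v θ)) p y)))
    {A : Set Θ} (hA : MeasurableSet A) {ε : ℝ} (hε : 0 < ε) :
    ∃ L ∈ likelihoods (fun θ => core (v θ)) p y,
      (∀ θ ∈ A, upperLik (likelihoods (fun θ => core (v θ)) p y) θ - ε ≤ L θ) ∧
      ∀ θ ∉ A, L θ ≤ lowerLik (likelihoods (fun θ => core (v θ)) p y) θ + ε := by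
  classical
  obtain ⟨L₀, hL₀⟩ := hne
  set 𝓛 := likelihoods (fun θ => core (v θ)) p y
  -- Truncating one fixed measurable likelihood avoids measurable selection. The margin `ε` ensures
  -- that at each point some likelihood passes the truncation level.
  let f : Θ → ℝ := A.piecewise (fun θ => max (L₀ θ) (upperLik 𝓛 θ - ε))
    (fun θ => min (L₀ θ) (lowerLik 𝓛 θ + ε))
  have hfA : ∀ θ ∈ A, f θ = max (L₀ θ) (upperLik 𝓛 θ - ε) := fun θ h => piecewise_eq_of_mem _ _ _ h
  have hfAc : ∀ θ ∉ A, f θ = min (L₀ θ) (lowerLik 𝓛 θ + ε) := fun θ h =>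
    piecewise_eq_of_notMem _ _ _ h
  refine ⟨f, mem_likelihoods_of_between hp hC
    (Measurable.piecewise hA (hL₀.1.1.max (hup.sub_const ε)) (hL₀.1.1.min (hlow.add_const ε)))
    fun θ => ?_, fun θ h => (hfA θ h).symm ▸ le_max_right _ _,
    fun θ h => (hfAc θ h).symm ▸ min_le_right _ _⟩
  by_cases hθ : θ ∈ A
  · rw [hfA θ hθ]
    obtain ⟨_, ⟨L, hL, rfl⟩, h⟩ := exists_lt_of_lt_csSup (⟨L₀ θ, L₀, hL₀, rfl⟩ :
      ((fun L : Θ → ℝ => L θ) '' 𝓛).Nonempty) (sub_lt_self (upperLik 𝓛 θ) hε)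
    rcases le_total (L₀ θ) (upperLik 𝓛 θ - ε) with h' | h'
    · exact ⟨L₀, hL₀, L, hL, le_max_left _ _, by rw [max_eq_right h']; exact h.le⟩
    · exact ⟨L₀, hL₀, L₀, hL₀, le_max_left _ _, by rw [max_eq_left h']⟩
  · rw [hfAc θ hθ]
    obtain ⟨_, ⟨L, hL, rfl⟩, h⟩ := exists_lt_of_csInf_lt (⟨L₀ θ, L₀, hL₀, rfl⟩ :
      ((fun L : Θ → ℝ => L θ) '' 𝓛).Nonempty) (lt_add_of_pos_right (lowerLik 𝓛 θ) hε)
    rcases le_total (L₀ θ) (lowerLik 𝓛 θ + ε) with h' | h'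
    · exact ⟨L₀, hL₀, L₀, hL₀, by rw [min_eq_left h'], min_le_left _ _⟩
    · exact ⟨L, hL, L₀, hL₀, by rw [min_eq_right h']; exact h.le, min_le_left _ _⟩

end Likelihood

/-! ### Posterior probabilities as ratios of prior integrals -/

section Posterior

variable {Θ : Type*} [MeasurableSpace Θ] {μ : Measure Θ} [SigmaFinite μ]

lemma integral_eq_indicator_add_compl {P : Measure Θ} {L : Θ → ℝ} (hL : Integrable L P) {A : Set Θ}
    (hA : MeasurableSet A) :
    ∫ θ, L θ ∂P = ∫ θ, A.indicator L θ ∂P + ∫ θ, Aᶜ.indicator L θ ∂P := by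
  rw [integral_indicator hA, integral_indicator hA.compl, integral_add_compl hA hL]

lemma integral_mul_rnDeriv {P : ProbabilityMeasure Θ} (hP : (P : Measure Θ) ≪ μ) (L : Θ → ℝ) :
    ∫ θ, L θ * ((P : Measure Θ).rnDeriv μ θ).toReal ∂μ = ∫ θ, L θ ∂(P : Measure Θ) := by
  simp_rw [mul_comm (L _)]
  exact integral_rnDeriv_smul hP

lemma lintegral_posterior_density {P : ProbabilityMeasure Θ} (hP : (P : Measure Θ) ≪ μ)
    {L : Θ → ℝ} (hL : L ∈ bddNonneg Θ) {A : Set Θ} (hA : MeasurableSet A) {I : ℝ} (hI : 0 ≤ I) :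
    ∫⁻ θ in A, ENNReal.ofReal (L θ * ((P : Measure Θ).rnDeriv μ θ).toReal / I) ∂μ =
      ENNReal.ofReal ((∫ θ, A.indicator L θ ∂(P : Measure Θ)) / I) := by
  have hint : Integrable (fun θ => L θ * ((P : Measure Θ).rnDeriv μ θ).toReal) μ := by
    simp_rw [mul_comm (L _)]
    exact (integrable_rnDeriv_smul_iff hP).2 (integrable_of_mem_bddNonneg hL _)
  rw [← ofReal_integral_eq_lintegral_ofReal (hint.div_const I).integrableOn
    (ae_of_all _ fun θ => div_nonneg (mul_nonneg (hL.2.1 θ) ENNReal.toReal_nonneg) hI),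
    integral_div, integral_indicator hA, ← setIntegral_toReal_rnDeriv_mul hP hA]
  simp_rw [mul_comm (L _)]

lemma posterior_real {P Q : ProbabilityMeasure Θ} (hP : (P : Measure Θ) ≪ μ) {L : Θ → ℝ}
    (hL : L ∈ bddNonneg Θ)
    (hQ : (Q : Measure Θ) = μ.withDensity (fun θ => ENNReal.ofReal
      (L θ * ((P : Measure Θ).rnDeriv μ θ).toReal /
        ∫ τ, L τ * ((P : Measure Θ).rnDeriv μ τ).toReal ∂μ)))
    {A : Set Θ} (hA : MeasurableSet A) :
    (Q : Measure Θ).real A =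
      (∫ θ, A.indicator L θ ∂(P : Measure Θ)) / ∫ θ, L θ ∂(P : Measure Θ) := by
  have hI : 0 ≤ ∫ θ, L θ ∂(P : Measure Θ) := integral_nonneg hL.2.1
  rw [hQ, integral_mul_rnDeriv hP, Measure.real, withDensity_apply _ hA,
    lintegral_posterior_density hP hL hA hI, ENNReal.toReal_ofReal]
  exact div_nonneg (integral_nonneg (indicator_mem_bddNonneg hL hA).2.1) hI

lemma exists_posterior {𝓟 : Set (ProbabilityMeasure Θ)} {𝓛 : Set (Θ → ℝ)}
    {P : ProbabilityMeasure Θ} (hP𝓟 : P ∈ 𝓟) (hP : (P : Measure Θ) ≪ μ) {L : Θ → ℝ} (hL𝓛 : L ∈ 𝓛)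
    (hL : L ∈ bddNonneg Θ) (hpos : 0 < ∫ θ, L θ ∂(P : Measure Θ)) :
    ∃ Q ∈ posteriors μ 𝓟 𝓛, ∀ A, MeasurableSet A → (Q : Measure Θ).real A =
      (∫ θ, A.indicator L θ ∂(P : Measure Θ)) / ∫ θ, L θ ∂(P : Measure Θ) := by
  let Q : ProbabilityMeasure Θ := ⟨μ.withDensity (fun θ => ENNReal.ofReal
      (L θ * ((P : Measure Θ).rnDeriv μ θ).toReal /
        ∫ τ, L τ * ((P : Measure Θ).rnDeriv μ τ).toReal ∂μ)), ⟨by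
    rw [integral_mul_rnDeriv hP, withDensity_apply _ .univ,
      lintegral_posterior_density hP hL .univ hpos.le, indicator_univ, div_self hpos.ne',
      ENNReal.ofReal_one]⟩⟩
  exact ⟨Q, ⟨P, hP𝓟, L, hL𝓛, by rwa [integral_mul_rnDeriv hP], rfl⟩,
    fun A hA => posterior_real hP hL rfl hA⟩

end Posterior

/-- Cross-multiplication reduces this to `x * b ≤ a * z`. If `x + z = 0`, the left side is zero by
the convention for division. -/
lemma div_add_le_div_add {x z a b : ℝ} (hx : 0 ≤ x) (hxa : x ≤ a) (hb : 0 ≤ b) (hbz : b ≤ z)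
    (hab : a + b ≠ 0) : x / (x + z) ≤ a / (a + b) := by
  have hab' : 0 < a + b := lt_of_le_of_ne (by linarith) hab.symm
  rcases (show 0 ≤ x + z by linarith).eq_or_lt with h | h
  · rw [← h, div_zero]
    exact div_nonneg (hx.trans hxa) hab'.le
  · rw [div_le_div_iff₀ h hab']
    nlinarith [mul_le_mul hxa hbz hb (hx.trans hxa)]

end UpperBayes

/-! ### Bayes' theorem for upper probabilities -/

theorem theorem1 {Θ D : Type*} [MeasurableSpace Θ] [MeasurableSpace D]
    -- prior side: `prior` is the core of the upper prior `Pup` of a set `𝓟` of priors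
    (μ : Measure Θ) [SigmaFinite μ]
    (𝓟 : Set (ProbabilityMeasure Θ))
    (Pup : Set Θ → ℝ) (hPup : Pup = UpperBayes.upperProb 𝓟)
    (prior : Set (ProbabilityMeasure Θ)) (hprior : prior = UpperBayes.core Pup)
    (hprior_ne : prior.Nonempty)
    (hprior_cl : UpperBayes.IsWeakStarClosed prior)
    (hprior_ac : ∀ P ∈ prior, (P : Measure Θ) ≪ μ)
    -- likelihood side: for every `θ`, `K θ` is the core of the upper probability of `𝓛₀ θ`
    (ν : Measure D) [SigmaFinite ν]
    (𝓛₀ : Θ → Set (ProbabilityMeasure D))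
    (K : Θ → Set (ProbabilityMeasure D))
    (hK : ∀ θ, K θ = UpperBayes.core (UpperBayes.upperProb (𝓛₀ θ)))
    (hK_ne : ∀ θ, (K θ).Nonempty)
    (hK_cl : ∀ θ, UpperBayes.IsWeakStarClosed (K θ))
    (p : Θ → ProbabilityMeasure D → D → ℝ)
    (hp : UpperBayes.IsDensityVersion ν K p)
    (y : D)
    (hp_bdd : ∃ C : ℝ, ∀ θ, ∀ P ∈ K θ, p θ P y ≤ C)
    -- likelihood functions at the datum `y`, with their upper and lower envelopes
    (𝓛 : Set (Θ → ℝ)) (h𝓛 : 𝓛 = UpperBayes.likelihoods K p y)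
    (Lup Llow : Θ → ℝ)
    (hLup : Lup = UpperBayes.upperLik 𝓛) (hLlow : Llow = UpperBayes.lowerLik 𝓛)
    (hLup_meas : Measurable Lup) (hLlow_meas : Measurable Llow)
    (A : Set Θ) (hA : MeasurableSet A)
    -- numerators and denominators of the two ratios
    (a c a' c' : ℝ)
    (ha : a = UpperBayes.supExp prior (A.indicator Lup))
    (hc : c = a + UpperBayes.infExp prior (Aᶜ.indicator Llow))
    (ha' : a' = UpperBayes.choquet Pup (A.indicator Lup))
    (hc' : c' = a' + UpperBayes.choquet (UpperBayes.conj Pup) (Aᶜ.indicator Llow)) :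
    (c ≠ 0 → (UpperBayes.posteriors μ prior 𝓛).Nonempty ∧
      UpperBayes.upperProb (UpperBayes.posteriors μ prior 𝓛) A ≤ a / c) ∧
    (c ≠ 0 → c' ≠ 0 → a / c ≤ a' / c') ∧
    (UpperBayes.Concave Pup →
      (c ≠ 0 → UpperBayes.upperProb (UpperBayes.posteriors μ prior 𝓛) A = a / c) ∧
      (c ≠ 0 → c' ≠ 0 → a / c = a' / c')) := by
  subst hPup hprior h𝓛 hLup hLlow
  obtain rfl : K = fun θ => UpperBayes.core (UpperBayes.upperProb (𝓛₀ θ)) := funext hK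
  obtain ⟨C, hC⟩ := hp_bdd
  set 𝓛 := UpperBayes.likelihoods
    (fun θ => UpperBayes.core (UpperBayes.upperProb (𝓛₀ θ))) p y
  have h𝓟 := UpperBayes.nonempty_of_core_upperProb hprior_ne
  have hbdd : ∀ L ∈ 𝓛, L ∈ UpperBayes.bddNonneg Θ := fun L hL => hL.1
  have hup := UpperBayes.upperLik_mem_bddNonneg hC hLup_meas
  have hlow := UpperBayes.lowerLik_mem_bddNonneg hC hLlow_meas
  have hf := UpperBayes.indicator_mem_bddNonneg hup hA
  have hg := UpperBayes.indicator_mem_bddNonneg hlow hA.compl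
  set b := UpperBayes.infExp (UpperBayes.core (UpperBayes.upperProb 𝓟))
    (Aᶜ.indicator (UpperBayes.lowerLik 𝓛)) with hb
  set b' := UpperBayes.choquet (UpperBayes.conj (UpperBayes.upperProb 𝓟))
    (Aᶜ.indicator (UpperBayes.lowerLik 𝓛)) with hb'
  subst hc hc'
  have ha0 : 0 ≤ a := ha ▸ UpperBayes.supExp_nonneg hf
  have hb0 : 0 ≤ b := UpperBayes.infExp_nonneg hg
  have hb0' : 0 ≤ b' := UpperBayes.choquet_nonneg (UpperBayes.conj_upperProb_nonneg 𝓟) _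
  have haa' : a ≤ a' := by
    rw [ha, ha']
    exact UpperBayes.supExp_le_choquet hf
  have hbb' : b' ≤ b := UpperBayes.choquet_conj_le_infExp hprior_ne hg
  -- Without likelihoods both envelopes would be zero, as `sSup ∅ = sInf ∅ = 0` in `ℝ`, forcing `a +
  -- b = 0`.
  have hne : a + b ≠ 0 → 𝓛.Nonempty := fun h => by
    by_contra! hemp
    apply h
    rw [ha, hb]
    have h₁ : UpperBayes.upperLik (∅ : Set (Θ → ℝ)) = 0 := by ext; simp [UpperBayes.upperLik]
    have h₂ : UpperBayes.lowerLik (∅ : Set (Θ → ℝ)) = 0 := by ext; simp [UpperBayes.lowerLik]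
    simp [h₁, h₂, hemp, UpperBayes.supExp, UpperBayes.infExp, hprior_ne.image_const]
  have hlower : ∀ L ∈ 𝓛, ∀ P ∈ UpperBayes.core (UpperBayes.upperProb 𝓟),
      b ≤ ∫ θ, Aᶜ.indicator L θ ∂(P : Measure Θ) := fun L hL P hP =>
    (UpperBayes.infExp_le_integral hg hP).trans <| integral_mono
      (UpperBayes.integrable_of_mem_bddNonneg hg _)
      (UpperBayes.integrable_of_mem_bddNonneg
        (UpperBayes.indicator_mem_bddNonneg (hbdd L hL) hA.compl) _)
      fun θ => indicator_le_indicator (UpperBayes.lowerLik_le hL θ)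
  have hupper : ∀ L ∈ 𝓛, ∀ P ∈ UpperBayes.core (UpperBayes.upperProb 𝓟),
      ∫ θ, A.indicator L θ ∂(P : Measure Θ) ≤ a := fun L hL P hP => by
    rw [ha]
    refine (integral_mono
      (UpperBayes.integrable_of_mem_bddNonneg
        (UpperBayes.indicator_mem_bddNonneg (hbdd L hL) hA) _)
      (UpperBayes.integrable_of_mem_bddNonneg hf _)
      fun θ => ?_).trans (UpperBayes.integral_le_supExp hf hP)
    exact indicator_le_indicator (UpperBayes.le_upperLik hC hL θ)
  have hsplit : ∀ L ∈ 𝓛, ∀ P : ProbabilityMeasure Θ, ∫ θ, L θ ∂(P : Measure Θ) =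
      ∫ θ, A.indicator L θ ∂(P : Measure Θ) + ∫ θ, Aᶜ.indicator L θ ∂(P : Measure Θ) :=
    fun L hL P => UpperBayes.integral_eq_indicator_add_compl
      (UpperBayes.integrable_of_mem_bddNonneg (hbdd L hL) _) hA
  have hnn : ∀ B, MeasurableSet B → ∀ L ∈ 𝓛, ∀ P : ProbabilityMeasure Θ,
      0 ≤ ∫ θ, B.indicator L θ ∂(P : Measure Θ) := fun B hB L hL P =>
    integral_nonneg (UpperBayes.indicator_mem_bddNonneg (hbdd L hL) hB).2.1
  have hnear : 𝓛.Nonempty → ∀ ε > 0, ∃ L ∈ 𝓛, ∀ P : ProbabilityMeasure Θ,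
      ∫ θ, A.indicator (UpperBayes.upperLik 𝓛) θ ∂(P : Measure Θ) - ε ≤
        ∫ θ, A.indicator L θ ∂(P : Measure Θ) ∧
      ∫ θ, Aᶜ.indicator L θ ∂(P : Measure Θ) ≤
        ∫ θ, Aᶜ.indicator (UpperBayes.lowerLik 𝓛) θ ∂(P : Measure Θ) + ε := by
    intro hne ε hε
    obtain ⟨L, hL, h₁, h₂⟩ := UpperBayes.exists_likelihood_near_envelopes hp hC hne hLup_meas
      hLlow_meas hA hε
    refine ⟨L, hL, fun P => ?_⟩
    have hi₁ := UpperBayes.integrable_of_mem_bddNonneg hf (P : Measure Θ)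
    have hi₂ := UpperBayes.integrable_of_mem_bddNonneg hg (P : Measure Θ)
    have hi₃ := UpperBayes.integrable_of_mem_bddNonneg
      (UpperBayes.indicator_mem_bddNonneg (hbdd L hL) hA) (P : Measure Θ)
    have hi₄ := UpperBayes.integrable_of_mem_bddNonneg
      (UpperBayes.indicator_mem_bddNonneg (hbdd L hL) hA.compl) (P : Measure Θ)
    have hcst : ∫ _ : Θ, ε ∂(P : Measure Θ) = ε := by simp
    constructor
    · conv_lhs => rw [← hcst, ← integral_sub hi₁ (integrable_const ε)]
      refine integral_mono (hi₁.sub (integrable_const ε)) hi₃ fun θ => ?_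
      by_cases hθ : θ ∈ A
      · simpa [hθ] using h₁ θ hθ
      · simpa [hθ] using hε.le
    · conv_rhs => rw [← hcst, ← integral_add hi₂ (integrable_const ε)]
      refine integral_mono hi₄ (hi₂.add (integrable_const ε)) fun θ => ?_
      by_cases hθ : θ ∈ A
      · simpa [hθ] using hε.le
      · simpa [hθ] using h₂ θ hθ
  have hpost_le : a + b ≠ 0 → UpperBayes.upperProb (UpperBayes.posteriors μ
      (UpperBayes.core (UpperBayes.upperProb 𝓟)) 𝓛) A ≤ a / (a + b) := fun hc => by
    refine Real.sSup_le ?_ (div_nonneg ha0 (add_nonneg ha0 hb0))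
    rintro _ ⟨Q, ⟨P, hP, L, hL, -, hQ⟩, rfl⟩
    change (Q : Measure Θ).real A ≤ _
    rw [UpperBayes.posterior_real (hprior_ac P hP) (hbdd L hL) hQ hA, hsplit L hL P]
    exact UpperBayes.div_add_le_div_add (hnn A hA L hL P) (hupper L hL P hP) hb0
      (hlower L hL P hP) hc
  refine ⟨fun hc => ⟨?_, hpost_le hc⟩, fun hc hc' => ?_, fun hconc => ?_⟩
  · suffices h : ∃ P ∈ UpperBayes.core (UpperBayes.upperProb 𝓟), ∃ L ∈ 𝓛,
        0 < ∫ θ, L θ ∂(P : Measure Θ) by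
      obtain ⟨P, hP, L, hL, hpos⟩ := h
      obtain ⟨Q, hQ, -⟩ := UpperBayes.exists_posterior hP (hprior_ac P hP) hL (hbdd L hL) hpos
      exact ⟨Q, hQ⟩
    -- If `a = 0`, then `b > 0` and any prior and likelihood give positive evidence off `A`.
    -- Otherwise some prior gives the upper likelihood positive integral over `A`, and a likelihood
    -- within half of it keeps this positive.
    rcases ha0.eq_or_lt with h | h
    · obtain ⟨P, hP⟩ := hprior_ne
      obtain ⟨L, hL⟩ := hne hc
      refine ⟨P, hP, L, hL, ?_⟩
      have h₁ := hlower L hL P hP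
      have h₂ := hnn A hA L hL P
      have h₃ : 0 < b := lt_of_le_of_ne hb0 fun h' => hc (by rw [← h, ← h', add_zero])
      rw [hsplit L hL P]
      linarith
    · rw [ha] at h
      obtain ⟨_, ⟨P, hP, rfl⟩, hpos⟩ := exists_lt_of_lt_csSup (hprior_ne.image _) h
      obtain ⟨L, hL, hLP⟩ := hnear (hne hc) _ (half_pos hpos)
      refine ⟨P, hP, L, hL, ?_⟩
      have h₁ := (hLP P).1
      have h₂ := hnn Aᶜ hA.compl L hL P
      rw [hsplit L hL P]
      linarith
  · exact UpperBayes.div_add_le_div_add ha0 haa' hb0' hbb' hc'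
  · obtain ⟨P, hP, hPf, hPg⟩ := UpperBayes.exists_mem_core_integral_eq_choquet h𝓟 hprior_cl hconc
      hf hg (A := A) (fun θ hθ => by simp [hθ]) (fun θ hθ => by simp [hθ])
    rw [← ha'] at hPf
    rw [← hb'] at hPg
    have haeq : a = a' := by
      refine le_antisymm haa' ?_
      rw [ha, ← hPf]
      exact UpperBayes.integral_le_supExp hf hP
    have hbeq : b = b' := by
      refine le_antisymm ?_ hbb'
      rw [← hPg]
      exact UpperBayes.infExp_le_integral hg hP
    refine ⟨fun hc => le_antisymm (hpost_le hc) ?_, fun _ _ => by rw [haeq, hbeq]⟩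
    rcases ha0.eq_or_lt with h | h
    · rw [← h, zero_div]
      exact UpperBayes.upperProb_nonneg _ _
    refine le_of_forall_pos_le_add fun δ hδ => ?_
    have hcpos : 0 < a + b := by linarith
    -- `ε < a` keeps the normalizing constant positive; the second bound controls the final loss.
    obtain ⟨ε, hε, hεa, hεδ⟩ : ∃ ε > 0, ε < a ∧ ε / (a + b) ≤ δ :=
      ⟨min (a / 2) (δ * (a + b)), by positivity, (min_le_left _ _).trans_lt (half_lt_self h),
        (div_le_iff₀ hcpos).2 (min_le_right _ _)⟩
    obtain ⟨L, hL, hLP⟩ := hnear (hne hc) ε hε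
    obtain ⟨h₁, h₂⟩ := hLP P
    rw [hPf, ← haeq] at h₁
    rw [hPg, ← hbeq] at h₂
    have h₃ := hnn Aᶜ hA.compl L hL P
    obtain ⟨Q, hQ, hQA⟩ := UpperBayes.exists_posterior hP (hprior_ac P hP) hL (hbdd L hL)
      (by rw [hsplit L hL P]; linarith)
    have h₄ := UpperBayes.real_le_upperProb hQ A
    rw [hQA A hA, hsplit L hL P] at h₄
    -- With numerator part `a - ε` and complementary part `b + ε` the errors cancel in the
    -- denominator, so the loss is exactly `ε / (a + b)`.
    have h₅ := UpperBayes.div_add_le_div_add (sub_nonneg.2 hεa.le) h₁ h₃ h₂ (by linarith)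
    rw [sub_add_add_cancel, sub_div] at h₅
    linarith
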